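/- Let $H$ be a real Hilbert space, $L_0,\Gamma\in C^2(H,\mathbb R)$, and let $L_\varepsilon:H\to\mathbb R$ ($\varepsilon\in\mathbb R$) be functionals, of class $C^2$ for $|\varepsilon|$ small, with $$L_\varepsilon(z)=L_0(z)+\varepsilon\Gamma(z)+o(\varepsilon),$$ where $o(\varepsilon)$ is meant in the $C^2$ sense: the remainder $R_\varepsilon=L_\varepsilon-L_0-\varepsilon\Gamma$ (with $R_0=0$) and its first and second derivatives are $o(\varepsilon)$ as $\varepsilon\to0$, uniformly on a neighbourhood of each point of $H$. Assume: (A1) $\mathcal M\subset H$ is a $d$-dimensional embedded $C^2$-submanifold (without boundary) and $\nabla L_0(z)=0$ for all $z\in\mathcal M$; (A2) $T_z\mathcal M=\ker\nabla^2L_0(z)$ for all $z\in\mathcal M$; (A3) $\nabla^2L_0(z):H\to H$ is a Fredholm operator of index zero for all $z\in\mathcal M$; (A4) there are finite-dimensional $C^2$ manifolds (without boundary) $\mathcal G$ and $\mathcal N$, with $\mathcal N$ compact, a projection $\vartheta:\mathcal M\to\mathcal N$, and a $C^2$ diffeomorphism $\iota:\mathcal G\times\mathcal N\to\mathcal M$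 such that $\vartheta(\iota(g,\gamma))=\gamma$ for all $(g,\gamma)$; (A5) for all $(g,\gamma)\in\mathcal G\times\mathcal N$, the differential of $\Gamma\circ\iota$ at $(g,\gamma)$ vanishes on $T_\gamma\mathcal N\subset T_{(g,\gamma)}(\mathcal G\times\mathcal N)$. By (A5), $\gamma\mapsto\Gamma(\iota(g,\gamma))$ is locally constant for every $g$. Fix $\gamma_0\in\mathcal N$ and set $\tilde\Gamma(g)=\Gamma(\iota(g,\gamma_0))$ (if $\mathcal N$ is connected, then $\tilde\Gamma(g)=\Gamma(\iota(g,\gamma))$ for every $\gamma\in\mathcal N$). Suppose that some $\bar g\in\mathcal G$ is a strict local maximum or a strict local minimum of $\tilde\Gamma$; it may be degenerate. Then there are $\varepsilon_0>0$ and $C>0$ such that for every $\varepsilon$ with $|\varepsilon|<\varepsilon_0$ the functional $L_\varepsilon$ has a critical point of the form $u_\varepsilon=z_\varepsilon+w_\varepsilon$ with $z_\varepsilon\in\mathcal M$, $w_\varepsilon\in(T_{z_\varepsilon}\mathcal M)^\perp$ and $\|w_\varepsilon\|\le C|\varepsilon|$. -/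

import Mathlib

open Set Filter Topology Asymptotics
open scoped Manifold ContDiff

noncomputable section

/-- The Hessian `∇²f(z) : H → H` of a functional on a real Hilbert space: the derivative at `z` of
the gradient map of `f`. -/
def hessian {H : Type*} [NormedAddCommGroup H] [InnerProductSpace ℝ H] [CompleteSpace H]
    (f : H → ℝ) (z : H) : H →L[ℝ] H :=
  fderiv ℝ (gradient f) z

/-- A Fredholm operator whose index `dim ker T - dim coker T` is zero. -/
def IsFredholmIndexZero {H : Type*} [NormedAddCommGroup H] [InnerProductSpace ℝ H]
    (T : H →L[ℝ] H) : Prop :=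
  T.IsFredholm ∧ Module.finrank ℝ T.ker = Module.finrank ℝ (H ⧸ T.range)

/-- `R ε = o(ε)` as `ε → 0` in the sense of `C²` functionals: the values, the first and the second
derivatives of `R ε` are `o(ε)`, uniformly on a neighbourhood of each point
(equivalently, uniformly on each compact set). -/
def IsLittleOInC2 {H : Type*} [NormedAddCommGroup H] [NormedSpace ℝ H] (R : ℝ → H → ℝ) : Prop :=
  ∀ z₀ : H,
    (fun x : ℝ × H => R x.1 x.2) =o[𝓝 0 ×ˢ 𝓝 z₀] (fun x => x.1) ∧
    (fun x : ℝ × H => fderiv ℝ (R x.1) x.2) =o[𝓝 0 ×ˢ 𝓝 z₀] (fun x => x.1) ∧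
    (fun x : ℝ × H => fderiv ℝ (fderiv ℝ (R x.1)) x.2) =o[𝓝 0 ×ˢ 𝓝 z₀] (fun x => x.1)

/-- A `d`-dimensional embedded `C²`-submanifold (without boundary) of `H`: a subset `M` whose
subspace topology carries a `C²` manifold structure for which the inclusion is a `C²` embedding. -/
def IsC2Submanifold {H : Type*} [NormedAddCommGroup H] [NormedSpace ℝ H] (d : ℕ) (M : Set H)
    [ChartedSpace (EuclideanSpace ℝ (Fin d)) M] : Prop :=
  IsManifold (𝓡 d) 2 M ∧
    Manifold.IsSmoothEmbedding (𝓡 d) 𝓘(ℝ, H) 2 (Subtype.val : M → H)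

/-- The tangent space `T_z M`, as a linear subspace of `H`: the range of the derivative of the
inclusion `M → H`. -/
def tangentSubspace {H : Type*} [NormedAddCommGroup H] [NormedSpace ℝ H] (d : ℕ) {M : Set H}
    [ChartedSpace (EuclideanSpace ℝ (Fin d)) M] (z : M) : Submodule ℝ H :=
  LinearMap.range
    (show EuclideanSpace ℝ (Fin d) →L[ℝ] H from
      mfderiv (𝓡 d) 𝓘(ℝ, H) (Subtype.val : M → H) z).toLinearMap

/-- A strict local minimum. -/
def IsStrictLocalMin {X : Type*} [TopologicalSpace X] (f : X → ℝ) (a : X) : Prop :=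
  ∀ᶠ x in 𝓝[≠] a, f a < f x

/-- A strict local maximum. -/
def IsStrictLocalMax {X : Type*} [TopologicalSpace X] (f : X → ℝ) (a : X) : Prop :=
  ∀ᶠ x in 𝓝[≠] a, f x < f a

end

/-! The proof is a Lyapunov–Schmidt reduction to a finite-dimensional maximum problem on the
critical manifold. Let `P` be the orthogonal projection onto `T_z M`. The auxiliary problem asks for
a small `w ⟂ T_z M` with `∇L_ε(z + w) ∈ T_z M`. At `ε = 0`, `w = 0` its linearization is `(1 -
P)∇²L₀(z) + P`, invertible because the Hessian is symmetric and Fredholm with kernel `T_z M`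
(`exists_equiv_of_isFredholm`). Hence solutions of size `O(ε)` exist, uniformly for `z` in a compact
set, and small solutions are locally Lipschitz in `z` (`exists_lyapunovSchmidt`).

Since `L₀` is locally constant on `M` and `∇L₀ = 0` there, the reduced functional is `L_ε(z + w(z))
= const + εΓ(z) + o(ε)`. Around the strict extremum there is a compact region on whose boundary `Γ`
is worse by a fixed gap `δ`. For small `ε` the gap beats the error, so the reduced functional, with
the appropriate sign, has an interior maximum (`exists_critical_of_boundary_gap`).

Such a maximum is a free critical point (`eq_zero_of_eventually_le`). Differentiability of `w` is
never needed: moving `z` along the tangential gradient `τ` changes `⟪τ, w⟫` only by the small size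
of `w` times the variation of the tangent spaces, which cannot offset the first-order gain `‖τ‖²`.
-/

/-! ### Submanifold geometry: local retractions and Lipschitz tangent projections. -/

section Geometry

variable {H : Type*} [NormedAddCommGroup H]

/-- A function on a manifold whose derivative vanishes everywhere is locally constant. -/
theorem isLocallyConstant_of_mfderiv_eq_zero {n : ℕ} {X : Type*} [TopologicalSpace X]
    [ChartedSpace (EuclideanSpace ℝ (Fin n)) X] [IsManifold (𝓡 n) 2 X] {f : X → ℝ}
    (hf : ContMDiff (𝓡 n) 𝓘(ℝ, ℝ) 1 f)
    (h0 : ∀ x, mfderiv (𝓡 n) 𝓘(ℝ, ℝ) f x = 0) : IsLocallyConstant f := by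
  have : IsManifold (𝓡 n) 1 X := IsManifold.of_le (n := 2) (by norm_num)
  rw [IsLocallyConstant.iff_eventually_eq]
  intro x
  set φ := chartAt (EuclideanSpace ℝ (Fin n)) x with hφ
  have hx : φ x ∈ φ.target := φ.map_source (mem_chart_source _ x)
  have hd : ∀ y ∈ φ.target, HasFDerivAt (f ∘ φ.symm) (0 : EuclideanSpace ℝ (Fin n) →L[ℝ] ℝ) y := by
    intro y hy
    have h1 : MDifferentiableAt (𝓡 n) (𝓡 n) φ.symm y :=
      (contMDiffAt_symm_of_mem_maximalAtlas (n := 1)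
        (IsManifold.chart_mem_maximalAtlas x) hy).mdifferentiableAt one_ne_zero
    have h2 : MDifferentiableAt (𝓡 n) 𝓘(ℝ, ℝ) f (φ.symm y) :=
      (hf _).mdifferentiableAt one_ne_zero
    have h3 := h2.hasMFDerivAt.comp y h1.hasMFDerivAt
    rw [h0] at h3
    have h4 := h3.hasFDerivAt
    exact h4.congr_fderiv (ContinuousLinearMap.zero_comp _)
  obtain ⟨r, hr, hball⟩ := Metric.isOpen_iff.1 φ.open_target _ hx
  have hc : ∀ y ∈ Metric.ball (φ x) r, (f ∘ φ.symm) y = (f ∘ φ.symm) (φ x) := by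
    intro y hy
    refine (convex_ball (φ x) r).is_const_of_fderivWithin_eq_zero (𝕜 := ℝ)
      (fun y hy => (hd y (hball hy)).differentiableAt.differentiableWithinAt)
      (fun y hy => ?_) hy (Metric.mem_ball_self hr)
    exact (hd y (hball hy)).hasFDerivWithinAt.fderivWithin (Metric.isOpen_ball.uniqueDiffWithinAt hy)
  have h5 : ∀ᶠ y in 𝓝 x, φ y ∈ Metric.ball (φ x) r :=
    (φ.continuousAt (mem_chart_source _ x)).eventually (Metric.ball_mem_nhds _ hr)
  filter_upwards [h5, φ.open_source.mem_nhds (mem_chart_source _ x)] with y hy hys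
  have := hc _ hy
  simpa [φ.left_inv hys, φ.left_inv (mem_chart_source _ x)] using this

variable [InnerProductSpace ℝ H] {d : ℕ} {M : Set H}
  [ChartedSpace (EuclideanSpace ℝ (Fin d)) M]

/-- The inclusion of an embedded submanifold has local left inverses of class `C²`. -/
theorem IsC2Submanifold.exists_leftInverse (hM : IsC2Submanifold d M) (z₀ : M) :
    ∃ s : H → M, ContMDiffAt 𝓘(ℝ, H) (𝓡 d) 2 s z₀ ∧ ∀ᶠ z : M in 𝓝 z₀, s z = z := by
  have := hM.1
  have h := hM.2.isImmersion.isImmersionAt z₀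
  -- In slice charts the inclusion is `u ↦ (u, 0)`, so a left inverse is obtained by discarding the
  -- complementary component.
  have hw : ∀ z ∈ h.domChart.source, h.codChart z = h.equiv (h.domChart z, 0) := by
    intro z hz
    have h0 : h.domChart z ∈ (h.domChart.extend (𝓡 d)).target := by
      simpa using h.domChart.map_source hz
    have h1 := h.writtenInCharts h0
    simpa [h.domChart.left_inv hz] using h1
  have hl : ∀ z ∈ h.domChart.source,
      h.domChart.symm (h.equiv.symm (h.codChart z)).1 = z := by
    intro z hz
    rw [hw z hz]
    simp [h.domChart.left_inv hz]
  refine ⟨fun y => h.domChart.symm (h.equiv.symm (h.codChart y)).1, ?_, ?_⟩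
  · have h1 : ContMDiffAt 𝓘(ℝ, H) 𝓘(ℝ, H) 2 h.codChart (z₀ : H) :=
      contMDiffAt_of_mem_maximalAtlas h.codChart_mem_maximalAtlas h.mem_codChart_source
    let B : H →L[ℝ] EuclideanSpace ℝ (Fin d) :=
      (ContinuousLinearMap.fst ℝ _ h.complement).comp (h.equiv.symm : H →L[ℝ] EuclideanSpace ℝ (Fin d) × h.complement)
    have h2 : ContMDiffAt 𝓘(ℝ, H) (𝓡 d) 2 (fun y => B (h.codChart y)) (z₀ : H) :=
      B.contDiff.contMDiff.contMDiffAt.comp (z₀ : H) h1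
    have hB : B (h.codChart z₀) = h.domChart z₀ := by
      simp [B, hw z₀ h.mem_domChart_source]
    have h3 : ContMDiffAt (𝓡 d) (𝓡 d) 2 h.domChart.symm (B (h.codChart z₀)) :=
      contMDiffAt_symm_of_mem_maximalAtlas h.domChart_mem_maximalAtlas
        (hB ▸ h.domChart.map_source h.mem_domChart_source)
    exact h3.comp (z₀ : H) h2
  · filter_upwards [h.domChart.open_source.mem_nhds h.mem_domChart_source] with z hz
    exact hl z hz

/-- An embedded submanifold is locally a `C²` retract, and the derivative of the retraction at a
point of the submanifold is a projection onto the tangent space. -/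
theorem IsC2Submanifold.exists_retraction (hM : IsC2Submanifold d M) (z₀ : M) :
    ∃ ρ : H → H, ContDiffAt ℝ 2 ρ z₀ ∧ (∀ y, ρ y ∈ M) ∧
      ∀ᶠ z : M in 𝓝 z₀, ρ z = z ∧ DifferentiableAt ℝ ρ z ∧
        (∀ v, fderiv ℝ ρ z v ∈ tangentSubspace d z) ∧
        ∀ v ∈ tangentSubspace d z, fderiv ℝ ρ z v = v := by
  have := hM.1
  have : IsManifold (𝓡 d) 1 M := IsManifold.of_le (n := 2) (by norm_num)
  obtain ⟨s, hs, hsl⟩ := hM.exists_leftInverse z₀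
  have hv : ContMDiff (𝓡 d) 𝓘(ℝ, H) 2 (Subtype.val : M → H) := hM.2.contMDiff
  have hρ : ContMDiffAt 𝓘(ℝ, H) 𝓘(ℝ, H) 2 (fun y => (s y : H)) z₀ :=
    (hv _).comp (z₀ : H) hs
  refine ⟨fun y => s y, hρ.contDiffAt, fun y => (s y).2, ?_⟩
  have hs1 : ∀ᶠ z : M in 𝓝 z₀, ContMDiffAt 𝓘(ℝ, H) (𝓡 d) 2 s z :=
    continuousAt_subtype_val.eventually ((contMDiffAt_iff_contMDiffAt_nhds (by norm_num)).1 hs)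
  filter_upwards [hsl.eventually_nhds, hs1] with z hz hsz
  have hzz : s z = z := hz.self_of_nhds
  have hsd : MDifferentiableAt 𝓘(ℝ, H) (𝓡 d) s (z : H) := hsz.mdifferentiableAt two_ne_zero
  have hvd : ∀ x : M, MDifferentiableAt (𝓡 d) 𝓘(ℝ, H) (Subtype.val : M → H) x :=
    fun x => (hv x).mdifferentiableAt two_ne_zero
  have hcomp := (hvd (s z)).hasMFDerivAt.comp (z : H) hsd.hasMFDerivAt
  have hcf := hcomp.hasFDerivAt
  have hd : DifferentiableAt ℝ (fun y => (s y : H)) z := hcf.differentiableAt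
  refine ⟨congrArg _ hzz, hd, fun v => ?_, ?_⟩
  · have h1 : tangentSubspace d (s z) = tangentSubspace d z := by rw [hzz]
    rw [← h1]
    have h2 := hcomp.mfderiv
    rw [mfderiv_eq_fderiv] at h2
    exact ⟨_, (congrArg (fun T : H →L[ℝ] H => T v) h2).symm⟩
  -- Differentiate the identity `s ∘ val = val`, read in `H`, which holds near `z`.
  · rintro v ⟨u, rfl⟩
    have h2 : HasMFDerivAt (𝓡 d) 𝓘(ℝ, H) (fun x : M => (s x : H)) z
        ((fderiv ℝ (fun y => (s y : H)) z).comp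
          (mfderiv (𝓡 d) 𝓘(ℝ, H) (Subtype.val : M → H) z)) :=
      hd.hasFDerivAt.hasMFDerivAt.comp z (hvd z).hasMFDerivAt
    have h3 : HasMFDerivAt (𝓡 d) 𝓘(ℝ, H) (fun x : M => (s x : H)) z
        (mfderiv (𝓡 d) 𝓘(ℝ, H) (Subtype.val : M → H) z) :=
      (hvd z).hasMFDerivAt.congr_of_eventuallyEq (hz.mono fun x hx => congrArg _ hx)
    have h4 := h2.mfderiv.symm.trans h3.mfderiv
    exact congrArg (fun T : EuclideanSpace ℝ (Fin d) →L[ℝ] H => T u) h4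

instance tangentSubspace.finiteDimensional (z : M) :
    FiniteDimensional ℝ (tangentSubspace d z) := by
  unfold tangentSubspace
  infer_instance

/-- The norm of the difference of two orthogonal projections is controlled by any operators that
restrict to projections onto the two subspaces. -/
theorem norm_starProjection_sub_le {U V : Submodule ℝ H} [U.HasOrthogonalProjection]
    [V.HasOrthogonalProjection] (A B : H →L[ℝ] H) (hA : ∀ v ∈ U, A v = v) (hA' : ∀ v, A v ∈ U)
    (hB : ∀ v ∈ V, B v = v) (hB' : ∀ v, B v ∈ V) :
    ‖U.starProjection - V.starProjection‖ ≤ 2 * ‖A - B‖ := by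
  -- For `p ∈ U`, `A p = p` and `B p ∈ V`, so the part of `p` orthogonal to `V` is that of `(A - B)
  -- p`.
  have key : ∀ (U V : Submodule ℝ H) [U.HasOrthogonalProjection]
      [V.HasOrthogonalProjection] (A B : H →L[ℝ] H), (∀ v ∈ U, A v = v) → (∀ v, B v ∈ V) →
      ∀ x, ‖U.starProjection x - V.starProjection (U.starProjection x)‖ ≤ ‖A - B‖ * ‖x‖ := by
    intro U V _ _ A B hA hB x
    set p := U.starProjection x with hp
    have h1 : A p = p := hA _ (U.starProjection_apply_mem x)
    have h2 : V.starProjection (B p) = B p := V.starProjection_eq_self_iff.2 (hB p)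
    have h3 : p - V.starProjection p = Vᗮ.starProjection ((A - B) p) := by
      rw [Submodule.starProjection_orthogonal_val]
      simp [h1, h2]
    rw [h3]
    calc _ ≤ ‖(A - B) p‖ := Submodule.norm_starProjection_apply_le _ _
      _ ≤ ‖A - B‖ * ‖p‖ := (A - B).le_opNorm p
      _ ≤ ‖A - B‖ * ‖x‖ := by gcongr; exact Submodule.norm_starProjection_apply_le _ _
  refine ContinuousLinearMap.opNorm_le_bound _ (by positivity) fun x => ?_
  set y := x - U.starProjection x with hy
  have e1 : (U.starProjection - V.starProjection) x =
      (U.starProjection x - V.starProjection (U.starProjection x)) - V.starProjection y := by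
    simp [hy]
  -- Here `y ⟂ U`. For `q = V.starProjection y` this gives `‖q‖² = ⟪q - U.starProjection q, y⟫`, and
  -- `key` with the roles of `U` and `V` exchanged bounds the first factor. Arguing by contradiction
  -- makes `‖q‖` positive, so it can be cancelled.
  have e2 : ‖V.starProjection y‖ ≤ ‖A - B‖ * ‖x‖ := by
    by_contra! hlt
    set q := V.starProjection y with hq
    have hyx : ‖y‖ ≤ ‖x‖ := by
      rw [hy, ← Submodule.starProjection_orthogonal_val]
      exact Submodule.norm_starProjection_apply_le _ _
    have hqq : V.starProjection q = q :=
      V.starProjection_eq_self_iff.2 (V.starProjection_apply_mem y)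
    have h1 : inner ℝ q q = inner ℝ (q - U.starProjection q) y := by
      have a1 : inner ℝ q y = inner ℝ q q := by
        conv_lhs => rw [← hqq]
        rw [Submodule.inner_starProjection_left_eq_right]
      have a2 : inner ℝ (U.starProjection q) y = 0 := by
        rw [Submodule.inner_starProjection_left_eq_right, hy, map_sub,
          U.starProjection_eq_self_iff.2 (U.starProjection_apply_mem x)]
        simp
      rw [inner_sub_left, a1, a2, sub_zero]
    have h2 := key V U B A hB hA' q
    rw [hqq, norm_sub_rev B A] at h2
    have h3 := real_inner_le_norm (q - U.starProjection q) y
    rw [← h1, real_inner_self_eq_norm_sq] at h3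
    have hq0 : 0 < ‖q‖ := lt_of_le_of_lt (by positivity) hlt
    have h4 : ‖q‖ ^ 2 ≤ ‖A - B‖ * ‖q‖ * ‖x‖ := by
      refine h3.trans ?_
      gcongr
    nlinarith
  rw [e1]
  refine (norm_sub_le _ _).trans ?_
  linarith [key U V A B hA hB' x]

/-- The orthogonal projection onto the tangent space is locally Lipschitz along a
`C²`-submanifold. -/
theorem IsC2Submanifold.exists_lipschitz_starProjection (hM : IsC2Submanifold d M) (z₀ : M) :
    ∃ K : ℝ, 0 < K ∧ ∃ U ∈ 𝓝 z₀, ∀ z ∈ U, ∀ z' ∈ U,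
      ‖(tangentSubspace d z').starProjection - (tangentSubspace d z).starProjection‖ ≤
        K * ‖(z' : H) - z‖ := by
  obtain ⟨ρ, hρ, -, hr⟩ := hM.exists_retraction z₀
  -- The derivative of the retraction is a (possibly oblique) projection onto each nearby tangent
  -- space and is `C¹`, hence locally Lipschitz.
  have h1 : ContDiffAt ℝ 1 (fderiv ℝ ρ) (z₀ : H) := hρ.fderiv_right (by norm_num)
  obtain ⟨K, t, ht, hK⟩ := h1.exists_lipschitzOnWith
  refine ⟨2 * K + 1, by positivity, _,
    inter_mem hr (continuousAt_subtype_val.preimage_mem_nhds ht), ?_⟩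
  rintro z ⟨⟨-, -, hz1, hz2⟩, hzt⟩ z' ⟨⟨-, -, hz1', hz2'⟩, hzt'⟩
  refine (norm_starProjection_sub_le _ _ hz2' hz1' hz2 hz1).trans ?_
  have := hK.norm_sub_le hzt' hzt
  nlinarith [norm_nonneg ((z' : H) - z)]

end Geometry

/-! ### Hessian, gradient and value estimates for the perturbed functionals. -/

section Perturbation

variable {H : Type*} [NormedAddCommGroup H] [InnerProductSpace ℝ H] [CompleteSpace H]

/-- The inverse Riesz isomorphism, as a real continuous linear map. -/
noncomputable def rieszInv (H : Type*) [NormedAddCommGroup H] [InnerProductSpace ℝ H]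
    [CompleteSpace H] : StrongDual ℝ H →L[ℝ] H where
  toFun := (InnerProductSpace.toDual ℝ H).symm
  map_add' := map_add _
  map_smul' c T := by simp
  cont := (InnerProductSpace.toDual ℝ H).symm.continuous

theorem norm_rieszInv_apply (T : StrongDual ℝ H) : ‖rieszInv H T‖ = ‖T‖ :=
  (InnerProductSpace.toDual ℝ H).symm.norm_map T

theorem gradient_eq_rieszInv (f : H → ℝ) : gradient f = fun x => rieszInv H (fderiv ℝ f x) := rfl

theorem ContDiff.gradient {f : H → ℝ} (hf : ContDiff ℝ 2 f) : ContDiff ℝ 1 (gradient f) :=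
  (rieszInv H).contDiff.comp (hf.fderiv_right (m := 1) (by norm_num))

theorem hessian_eq {f : H → ℝ} (hf : ContDiff ℝ 2 f) (z : H) :
    hessian f z = (rieszInv H).comp (fderiv ℝ (fderiv ℝ f) z) := by
  have h : DifferentiableAt ℝ (fderiv ℝ f) z :=
    (hf.fderiv_right (m := 1) (by norm_num)).differentiable one_ne_zero z
  exact ((rieszInv H).hasFDerivAt.comp z h.hasFDerivAt).fderiv

theorem inner_hessian_comm {f : H → ℝ} (hf : ContDiff ℝ 2 f) (z u v : H) :
    inner ℝ (hessian f z u) v = inner ℝ u (hessian f z v) := by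
  have key : ∀ T : StrongDual ℝ H, ∀ v, inner ℝ (rieszInv H T) v = T v :=
    fun T v => InnerProductSpace.toDual_symm_apply
  have hs : IsSymmSndFDerivAt ℝ f z := hf.contDiffAt.isSymmSndFDerivAt (by simp)
  rw [hessian_eq hf, real_inner_comm (rieszInv H |>.comp _ v)]
  simp only [ContinuousLinearMap.comp_apply, key]
  exact hs u v

/-- Along a submanifold on which the Hessian is Fredholm with kernel the tangent space, the
linearized Lyapunov–Schmidt operator is invertible. -/
theorem exists_equiv_of_isFredholm {A : H →L[ℝ] H}
    (hsymm : ∀ u v, inner ℝ (A u) v = inner ℝ u (A v)) (hA : A.IsFredholm)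
    {T : Submodule ℝ H} [T.HasOrthogonalProjection] (hT : T = A.ker) :
    ∃ e : H ≃L[ℝ] H, (e : H →L[ℝ] H) =
      (ContinuousLinearMap.id ℝ H - T.starProjection).comp A + T.starProjection := by
  set P := T.starProjection with hP
  have hker : ∀ v, A v = 0 ↔ v ∈ T := by
    intro v; rw [hT]; exact Iff.rfl
  have hort : ∀ v, A v ∈ Tᗮ := by
    intro v
    rw [Submodule.mem_orthogonal]
    intro u hu
    rw [← hsymm, (hker u).2 hu, inner_zero_left]
  have hPA : ∀ v, P (A v) = 0 := fun v => (T.starProjection_apply_eq_zero_iff).2 (hort v)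
  have hAP : ∀ v, A (P v) = 0 := fun v => (hker _).2 (T.starProjection_apply_mem v)
  have hPP : ∀ v, P (P v) = P v :=
    fun v => T.starProjection_eq_self_iff.2 (T.starProjection_apply_mem v)
  set B : H →L[ℝ] H := (ContinuousLinearMap.id ℝ H - P).comp A + P with hB
  have hBv : ∀ v, B v = A v + P v := by intro v; simp [hB, hPA]
  have hinj : B.ker = ⊥ := by
    rw [eq_bot_iff]
    intro v hv
    have h0 : A v + P v = 0 := by rw [← hBv]; exact hv
    have h1 : P v = 0 := by
      have := congrArg P h0
      simpa [hPA, hPP] using this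
    have h2 : v ∈ T := (hker v).1 (by simpa [h1] using h0)
    rw [Submodule.mem_bot, ← h1]
    exact (T.starProjection_eq_self_iff.2 h2).symm
  -- The range is closed by the Fredholm property, and its orthogonal complement is `ker A = T` by
  -- symmetry.
  have hrange : Tᗮ ≤ A.range := by
    have hc : IsClosed (A.range : Set H) := hA.isClosed_range
    have : CompleteSpace A.range := hc.completeSpace_coe
    rw [← Submodule.orthogonal_orthogonal A.range]
    apply Submodule.orthogonal_le
    intro v hv
    rw [← hker]
    have h1 : ∀ u, inner ℝ (A u) v = 0 := fun u =>
      (Submodule.mem_orthogonal _ _).1 hv _ ⟨u, rfl⟩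
    have h2 := h1 (A v)
    rw [hsymm] at h2
    exact inner_self_eq_zero.1 h2
  have hsurj : B.range = ⊤ := by
    rw [eq_top_iff]
    intro y _
    obtain ⟨x, hx⟩ := hrange (T.sub_starProjection_mem_orthogonal y)
    have hx' : A x = y - P y := hx
    refine ⟨x - P x + P y, ?_⟩
    change B _ = y
    rw [hBv]
    simp [hAP, hPP, hx']
  exact ⟨ContinuousLinearEquiv.ofBijective B hinj hsurj,
    ContinuousLinearEquiv.coe_ofBijective B hinj hsurj⟩

section Expansion

variable {L₀ Γ : H → ℝ} {L : ℝ → H → ℝ} (hL₀ : ContDiff ℝ 2 L₀) (hΓ : ContDiff ℝ 2 Γ)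
  (hL : ∀ᶠ ε in 𝓝 (0 : ℝ), ContDiff ℝ 2 (L ε))
  (hexp : IsLittleOInC2 (fun ε z => L ε z - (L₀ z + ε * Γ z)))

omit [CompleteSpace H] in
include hL₀ hΓ in
theorem fderiv_remainder {ε : ℝ} (hε : ContDiff ℝ 2 (L ε)) :
    fderiv ℝ (fun z => L ε z - (L₀ z + ε * Γ z)) =
      fun z => fderiv ℝ (L ε) z - (fderiv ℝ L₀ z + ε • fderiv ℝ Γ z) := by
  funext z
  have h1 := (hε.differentiable two_ne_zero z).hasFDerivAt
  have h2 := (hL₀.differentiable two_ne_zero z).hasFDerivAt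
  have h3 := (hΓ.differentiable two_ne_zero z).hasFDerivAt
  exact (h1.sub (h2.add (h3.const_mul ε))).fderiv

include hL₀ hΓ hL hexp

/-- Convergence jointly in `(ε, z)` keeps the linearized auxiliary equation close to its invertible
limit on a whole neighbourhood of `(0, z₀)`. -/
theorem tendsto_hessian (z₀ : H) :
    Tendsto (fun x : ℝ × H => hessian (L x.1) x.2) (𝓝 0 ×ˢ 𝓝 z₀) (𝓝 (hessian L₀ z₀)) := by
  have hd : ∀ {f : H → ℝ}, ContDiff ℝ 2 f → ContDiff ℝ 1 (fderiv ℝ f) :=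
    fun hf => hf.fderiv_right (by norm_num)
  have h0 : Tendsto (fun x : ℝ × H =>
      fderiv ℝ (fderiv ℝ (fun z => L x.1 z - (L₀ z + x.1 * Γ z))) x.2) (𝓝 0 ×ˢ 𝓝 z₀) (𝓝 0) :=
    IsLittleO.trans_tendsto (E'' := H →L[ℝ] StrongDual ℝ H) (F'' := ℝ) (hexp z₀).2.2
    (show Tendsto (fun x : ℝ × H => x.1) (𝓝 0 ×ˢ 𝓝 z₀) (𝓝 0) from tendsto_fst)
  have hc : ∀ {f : H → ℝ}, ContDiff ℝ 2 f →
      Tendsto (fun x : ℝ × H => fderiv ℝ (fderiv ℝ f) x.2) (𝓝 0 ×ˢ 𝓝 z₀)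
        (𝓝 (fderiv ℝ (fderiv ℝ f) z₀)) := fun hf =>
    (((hd hf).continuous_fderiv one_ne_zero).tendsto z₀).comp tendsto_snd
  have h1 := (h0.add ((hc hL₀).add ((tendsto_fst (f := 𝓝 (0 : ℝ)) (g := 𝓝 z₀)).smul (hc hΓ))))
  rw [zero_smul, add_zero, zero_add] at h1
  rw [hessian_eq hL₀]
  have h2 := ((ContinuousLinearMap.compL ℝ H (StrongDual ℝ H) H (rieszInv H)).continuous.tendsto
    _).comp h1
  refine h2.congr' ?_
  filter_upwards [(tendsto_fst (f := 𝓝 (0 : ℝ)) (g := 𝓝 z₀)).eventually hL] with x hx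
  have h3 : fderiv ℝ (fderiv ℝ (fun z => L x.1 z - (L₀ z + x.1 * Γ z))) x.2 =
      fderiv ℝ (fderiv ℝ (L x.1)) x.2 -
        (fderiv ℝ (fderiv ℝ L₀) x.2 + x.1 • fderiv ℝ (fderiv ℝ Γ) x.2) := by
    rw [fderiv_remainder hL₀ hΓ hx]
    have h1 := ((hd hx).differentiable one_ne_zero x.2).hasFDerivAt
    have h2 := ((hd hL₀).differentiable one_ne_zero x.2).hasFDerivAt
    have h3 := ((hd hΓ).differentiable one_ne_zero x.2).hasFDerivAt
    exact (h1.sub (h2.add (h3.const_smul x.1))).fderiv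
  simp only [Function.comp_apply, h3, hessian_eq hx, ContinuousLinearMap.compL_apply]
  congr 1
  abel

/-- On the critical manifold `∇L₀` vanishes, so this bounds the residual of the auxiliary equation
at `w = 0` and is the source of `‖w‖ ≤ C|ε|`. -/
theorem exists_norm_gradient_sub_le (z₀ : H) :
    ∃ C : ℝ, 0 < C ∧ ∀ᶠ x : ℝ × H in 𝓝 0 ×ˢ 𝓝 z₀,
      ‖gradient (L x.1) x.2 - gradient L₀ x.2‖ ≤ C * |x.1| := by
  have h0 := (hexp z₀).2.1.bound one_pos
  have hc : ContinuousAt (fun z => ‖fderiv ℝ Γ z‖) z₀ :=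
    (hΓ.continuous_fderiv two_ne_zero).norm.continuousAt
  have h1 : ∀ᶠ z in 𝓝 z₀, ‖fderiv ℝ Γ z‖ < ‖fderiv ℝ Γ z₀‖ + 1 :=
    hc.eventually (gt_mem_nhds (lt_add_one _))
  refine ⟨‖fderiv ℝ Γ z₀‖ + 2, by positivity, ?_⟩
  filter_upwards [h0, tendsto_snd.eventually h1, tendsto_fst.eventually hL] with x h0 h1 hx
  rw [fderiv_remainder hL₀ hΓ hx, one_mul, Real.norm_eq_abs] at h0
  simp only [gradient_eq_rieszInv, ← map_sub, norm_rieszInv_apply]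
  calc ‖fderiv ℝ (L x.1) x.2 - fderiv ℝ L₀ x.2‖
      = ‖(fderiv ℝ (L x.1) x.2 - (fderiv ℝ L₀ x.2 + x.1 • fderiv ℝ Γ x.2)) +
          x.1 • fderiv ℝ Γ x.2‖ := by congr 1; abel
    _ ≤ |x.1| + |x.1| * ‖fderiv ℝ Γ x.2‖ := by
        refine (norm_add_le _ _).trans (add_le_add h0 ?_)
        rw [norm_smul, Real.norm_eq_abs]
    _ ≤ (‖fderiv ℝ Γ z₀‖ + 2) * |x.1| := by nlinarith [abs_nonneg x.1]

omit hL in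
/-- First-order expansion of `L ε` at a point close to a critical point of `L₀`. -/
theorem eventually_abs_sub_le {z₀ : H} (hz₀ : gradient L₀ z₀ = 0) {η : ℝ} (hη : 0 < η) :
    ∀ᶠ x : (ℝ × H) × H in 𝓝 ((0, 0), z₀),
      |L x.1.1 (x.2 + x.1.2) - (L₀ x.2 + x.1.1 * Γ x.2)| ≤ η * (|x.1.1| + ‖x.1.2‖) := by
  -- Strict differentiability gives `L₀(z + w) - L₀(z) = o(‖w‖)` uniformly in base points `z` near
  -- `z₀`.
  have hf : HasStrictFDerivAt L₀ (0 : H →L[ℝ] ℝ) z₀ := by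
    have h1 := hL₀.contDiffAt.hasStrictFDerivAt (x := z₀) two_ne_zero
    have h2 : fderiv ℝ L₀ z₀ = 0 := by
      rw [← norm_eq_zero, ← norm_rieszInv_apply]
      exact norm_eq_zero.2 hz₀
    rwa [h2] at h1
  have hy : Tendsto (fun x : (ℝ × H) × H => x.2 + x.1.2) (𝓝 ((0, 0), z₀)) (𝓝 z₀) := by
    have : Continuous (fun x : (ℝ × H) × H => x.2 + x.1.2) := by fun_prop
    simpa using this.tendsto ((0, 0), z₀)
  have hz : Tendsto (fun x : (ℝ × H) × H => x.2) (𝓝 ((0, 0), z₀)) (𝓝 z₀) :=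
    continuous_snd.tendsto ((0, 0), z₀)
  have he : Tendsto (fun x : (ℝ × H) × H => x.1.1) (𝓝 ((0, 0), z₀)) (𝓝 0) :=
    (continuous_fst.comp continuous_fst).tendsto ((0, 0), z₀)
  have h1 := (hy.prodMk_nhds hz).eventually (hf.isLittleO.bound hη)
  have h2 := (he.prodMk hy).eventually ((hexp z₀).1.bound (half_pos hη))
  have h3 : ∀ᶠ x : (ℝ × H) × H in 𝓝 ((0, 0), z₀), |Γ (x.2 + x.1.2) - Γ x.2| < η / 2 := by
    have h4 := ((hΓ.continuous.tendsto z₀).comp hy).sub ((hΓ.continuous.tendsto z₀).comp hz)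
    rw [sub_self] at h4
    have h5 := h4.abs
    rw [abs_zero] at h5
    exact h5.eventually (gt_mem_nhds (half_pos hη))
  filter_upwards [h1, h2, h3] with x h1 h2 h3
  simp only [zero_apply, sub_zero, add_sub_cancel_left, Real.norm_eq_abs] at h1 h2
  have e : L x.1.1 (x.2 + x.1.2) - (L₀ x.2 + x.1.1 * Γ x.2) =
      (L x.1.1 (x.2 + x.1.2) - (L₀ (x.2 + x.1.2) + x.1.1 * Γ (x.2 + x.1.2))) +
      (L₀ (x.2 + x.1.2) - L₀ x.2) + x.1.1 * (Γ (x.2 + x.1.2) - Γ x.2) := by ring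
  rw [e]
  refine (abs_add_le _ _).trans ?_
  have h6 := abs_add_le (L x.1.1 (x.2 + x.1.2) - (L₀ (x.2 + x.1.2) + x.1.1 * Γ (x.2 + x.1.2)))
    (L₀ (x.2 + x.1.2) - L₀ x.2)
  rw [abs_mul]
  have h7 := mul_le_mul_of_nonneg_left h3.le (abs_nonneg x.1.1)
  linarith

end Expansion

end Perturbation

/-! ### The auxiliary equation and the natural constraint. -/

section LyapunovSchmidt

variable {H : Type*} [NormedAddCommGroup H] [InnerProductSpace ℝ H]

/-- The Lyapunov–Schmidt map of a vector field `g` at `z`, relative to an orthogonal projection `P`: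
its zeros are the `w ∈ ker P` with `g (z + w) ∈ range P`. -/
def lyapunovSchmidtMap (P : H →L[ℝ] H) (g : H → H) (z w : H) : H :=
  (ContinuousLinearMap.id ℝ H - P) (g (z + w)) + P w

/-- The two summands of the map lie in `Tᗮ` and `T`, so they vanish separately; both conditions thus
become one equation in the fixed space `H`, whatever the base point. -/
theorem lyapunovSchmidtMap_eq_zero_iff {T : Submodule ℝ H} [T.HasOrthogonalProjection]
    {g : H → H} {z w : H} :
    lyapunovSchmidtMap T.starProjection g z w = 0 ↔ w ∈ Tᗮ ∧ g (z + w) ∈ T := by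
  set P := T.starProjection with hP
  have hPP : ∀ v, P (P v) = P v :=
    fun v => T.starProjection_eq_self_iff.2 (T.starProjection_apply_mem v)
  rw [← T.starProjection_apply_eq_zero_iff, ← T.starProjection_eq_self_iff, ← hP]
  simp only [lyapunovSchmidtMap, sub_apply, ContinuousLinearMap.id_apply]
  constructor
  · intro h
    have h1 : P w = 0 := by
      have := congrArg P h
      simpa [hPP] using this
    rw [h1, add_zero, sub_eq_zero] at h
    exact ⟨h1, h.symm⟩
  · rintro ⟨h1, h2⟩
    rw [h1, h2, sub_self, add_zero]

/-- Uniform local solvability of the auxiliary equation: for small parameters the zeros `w` of the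
Lyapunov–Schmidt map exist, are of the order of the parameter, and depend on the base point in a
locally Lipschitz way. -/
theorem exists_lyapunovSchmidt [CompleteSpace H] {M : Set H} {P : M → H →L[ℝ] H} {z₀ : M}
    {g : ℝ → H → H} {A : H →L[ℝ] H} (hP1 : ∀ z, ‖P z‖ ≤ 1)
    (hP : ∃ K : ℝ, 0 < K ∧ ∃ U ∈ 𝓝 z₀, ∀ z ∈ U, ∀ z' ∈ U,
      ‖P z' - P z‖ ≤ K * ‖(z' : H) - z‖)
    (hg : ∀ᶠ ε in 𝓝 (0 : ℝ), ContDiff ℝ 1 (g ε))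
    (hA : Tendsto (fun x : ℝ × H => fderiv ℝ (g x.1) x.2) (𝓝 0 ×ˢ 𝓝 (z₀ : H)) (𝓝 A))
    (hb : ∃ C : ℝ, 0 < C ∧ ∀ᶠ x : ℝ × M in 𝓝 (0, z₀), ‖g x.1 x.2‖ ≤ C * |x.1|)
    {e : H ≃L[ℝ] H}
    (he : (e : H →L[ℝ] H) = (ContinuousLinearMap.id ℝ H - P z₀).comp A + P z₀) :
    ∃ C : ℝ, 0 < C ∧ ∃ r : ℝ, 0 < r ∧ ∀ᶠ x : ℝ × M in 𝓝 (0, z₀),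
      (∃ w : H, ‖w‖ ≤ C * |x.1| ∧ lyapunovSchmidtMap (P x.2) (g x.1) x.2 w = 0) ∧
      ∀ w : H, ‖w‖ < r → lyapunovSchmidtMap (P x.2) (g x.1) x.2 w = 0 →
        ∃ K : ℝ, ∀ᶠ z' in 𝓝 x.2, ∀ w' : H, ‖w'‖ < r →
          lyapunovSchmidtMap (P z') (g x.1) z' w' = 0 → ‖w' - w‖ ≤ K * ‖(z' : H) - x.2‖ := by
  obtain ⟨K, hK, U, hU, hPU⟩ := hP
  obtain ⟨C, hC, hb⟩ := hb
  have hPc : ContinuousAt P z₀ := by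
    rw [ContinuousAt, tendsto_iff_norm_sub_tendsto_zero]
    have h1 : Tendsto (fun z : M => K * ‖(z : H) - z₀‖) (𝓝 z₀) (𝓝 0) := by
      have : Continuous (fun z : M => K * ‖(z : H) - z₀‖) := by fun_prop
      simpa using this.tendsto z₀
    refine squeeze_zero' (Eventually.of_forall fun _ => norm_nonneg _) ?_ h1
    filter_upwards [hU] with z hz
    exact hPU _ (mem_of_mem_nhds hU) _ hz
  have hQ1 : ∀ z v, ‖(ContinuousLinearMap.id ℝ H - P z) v‖ ≤ 2 * ‖v‖ := by
    intro z v
    have h1 := (P z).le_of_opNorm_le (hP1 z) v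
    have h2 := norm_sub_le v (P z v)
    simp only [sub_apply, ContinuousLinearMap.id_apply]
    linarith
  -- The added `1` keeps `N` positive even when `H` is trivial.
  set N : ℝ := ‖(e.symm : H →L[ℝ] H)‖ + 1 with hN
  have hN0 : 0 < N := by positivity
  have hsymm : ∀ v, ‖e.symm v‖ ≤ N * ‖v‖ := fun v =>
    ((e.symm : H →L[ℝ] H).le_opNorm v).trans (by gcongr; linarith)
  have hinv : ∀ v, N⁻¹ * ‖v‖ ≤ ‖e v‖ := by
    intro v
    rw [inv_mul_le_iff₀ hN0]
    simpa using hsymm (e v)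
  let R : (e : H →L[ℝ] H).NonlinearRightInverse :=
    { toFun := e.symm
      nnnorm := ⟨N, hN0.le⟩
      bound' := hsymm
      right_inv' := fun v => e.apply_symm_apply v }
  -- Half of the lower bound `N⁻¹` for `e`: a `κ`-approximation by `e` stays quantitatively
  -- invertible.
  let κ : NNReal := ⟨N⁻¹ / 2, by positivity⟩
  have hκ : (κ : ℝ) = N⁻¹ / 2 := rfl
  have hκ0 : (0 : ℝ) < κ := by rw [hκ]; positivity
  -- closeness of the derivative to `e`
  have hder : ∃ r > 0, ∀ᶠ x : ℝ × M in 𝓝 (0, z₀),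
      ApproximatesLinearOn (lyapunovSchmidtMap (P x.2) (g x.1) x.2) (e : H →L[ℝ] H)
        (Metric.ball 0 r) κ := by
    have t1 : Tendsto (fun x : (ℝ × M) × H => (x.1.1, (x.1.2 : H) + x.2))
        (𝓝 (0, z₀) ×ˢ 𝓝 0) (𝓝 0 ×ˢ 𝓝 (z₀ : H)) := by
      rw [← nhds_prod_eq, ← nhds_prod_eq]
      have : Continuous (fun x : (ℝ × M) × H => (x.1.1, (x.1.2 : H) + x.2)) := by fun_prop
      simpa using this.tendsto ((0, z₀), 0)
    have t2 : Tendsto (fun x : (ℝ × M) × H => P x.1.2) (𝓝 (0, z₀) ×ˢ 𝓝 0) (𝓝 (P z₀)) := by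
      rw [← nhds_prod_eq]
      have : Tendsto (fun x : (ℝ × M) × H => x.1.2) (𝓝 ((0, z₀), 0)) (𝓝 z₀) :=
        (continuous_snd.comp continuous_fst).tendsto ((0, z₀), 0)
      exact hPc.tendsto.comp this
    have t3 : Tendsto (fun x : (ℝ × M) × H =>
        (ContinuousLinearMap.id ℝ H - P x.1.2).comp
          (fderiv ℝ (g x.1.1) ((x.1.2 : H) + x.2)) + P x.1.2) (𝓝 (0, z₀) ×ˢ 𝓝 0)
        (𝓝 (e : H →L[ℝ] H)) := by
      rw [he]
      have h1 := hA.comp t1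
      have h2 : Tendsto (fun x : (ℝ × M) × H => ContinuousLinearMap.id ℝ H - P x.1.2)
          (𝓝 (0, z₀) ×ˢ 𝓝 0) (𝓝 (ContinuousLinearMap.id ℝ H - P z₀)) :=
        tendsto_const_nhds.sub t2
      have h3 := ((isBoundedBilinearMap_comp (𝕜 := ℝ) (E := H) (F := H) (G := H)).continuous.tendsto
        (ContinuousLinearMap.id ℝ H - P z₀, A)).comp (h2.prodMk_nhds h1)
      exact h3.add t2
    have h4 := t3.eventually (Metric.closedBall_mem_nhds _ hκ0)
    obtain ⟨pa, ha, pb, hb', hab⟩ := eventually_prod_iff.1 h4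
    obtain ⟨r, hr, hball⟩ := Metric.eventually_nhds_iff_ball.1 hb'
    refine ⟨r, hr, ?_⟩
    filter_upwards [ha, (continuous_fst.tendsto ((0 : ℝ), z₀)).eventually hg] with x hx hgx
    intro w hw w' hw'
    refine (convex_ball (0 : H) r).norm_image_sub_le_of_norm_hasFDerivWithin_le'
      (f' := fun v => (ContinuousLinearMap.id ℝ H - P x.2).comp
        (fderiv ℝ (g x.1) ((x.2 : H) + v)) + P x.2) (fun v hv => ?_) (fun v hv => ?_) hw' hw
    · have h5 : HasFDerivAt (fun v => g x.1 ((x.2 : H) + v))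
          (fderiv ℝ (g x.1) ((x.2 : H) + v)) v :=
        (hasFDerivAt_comp_add_left (x.2 : H)).2 (hgx.differentiable one_ne_zero _).hasFDerivAt
      exact (((ContinuousLinearMap.id ℝ H - P x.2).hasFDerivAt.comp v h5).add
        (P x.2).hasFDerivAt).hasFDerivWithinAt
    · have := hab hx (hball v hv)
      rwa [dist_eq_norm] at this
  obtain ⟨r, hr, happ⟩ := hder
  -- The residual at `w = 0` is at most `2C|ε|`, and the image of a ball of radius `R` covers radius
  -- `(N⁻¹ - κ)R = R / (2N)`; hence `R = 4CN|ε|`.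
  refine ⟨4 * C * N, by positivity, r, hr, ?_⟩
  have hsmall : ∀ᶠ x : ℝ × M in 𝓝 (0, z₀), 4 * C * N * |x.1| < r := by
    have : Continuous (fun x : ℝ × M => 4 * C * N * |x.1|) := by fun_prop
    exact (this.tendsto (0, z₀)).eventually (gt_mem_nhds (by simpa using hr))
  have hslice : ∀ {p : ℝ × M → Prop} {x : ℝ × M}, (∀ᶠ y in 𝓝 x, p y) →
      ∀ᶠ z' in 𝓝 x.2, p (x.1, z') := fun {p x} h =>
    (Continuous.prodMk_right x.1).continuousAt.eventually h
  filter_upwards [happ.eventually_nhds, hsmall, hb,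
    (continuous_snd.tendsto ((0 : ℝ), z₀)).eventually (eventually_mem_nhds_iff.2 hU),
    (continuous_fst.tendsto ((0 : ℝ), z₀)).eventually hg] with x hxa hxs hxb hxU hxg
  have hxa0 := hxa.self_of_nhds
  constructor
  · have hsub : Metric.closedBall (0 : H) (4 * C * N * |x.1|) ⊆ Metric.ball 0 r :=
      Metric.closedBall_subset_ball hxs
    have h1 := hxa0.surjOn_closedBall_of_nonlinearRightInverse R (by positivity) hsub
    have h2 : (0 : H) ∈ Metric.closedBall (lyapunovSchmidtMap (P x.2) (g x.1) x.2 0)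
        (((R.nnnorm : ℝ)⁻¹ - κ) * (4 * C * N * |x.1|)) := by
      have h3 : ((R.nnnorm : ℝ)⁻¹ - κ) = N⁻¹ / 2 := by
        change N⁻¹ - N⁻¹ / 2 = N⁻¹ / 2
        ring
      rw [h3, mem_closedBall_iff_norm, zero_sub, norm_neg]
      have h4 : N⁻¹ / 2 * (4 * C * N * |x.1|) = 2 * (C * |x.1|) := by
        field_simp
        ring
      rw [h4]
      simp only [lyapunovSchmidtMap, add_zero, map_zero]
      exact (hQ1 _ _).trans (by gcongr)
    obtain ⟨w, hw, hw0⟩ := h1 h2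
    exact ⟨w, by simpa using hw, hw0⟩
  · intro w hw hw0
    have hd : DifferentiableAt ℝ (fun y => g x.1 (y + w)) (x.2 : H) :=
      (differentiableAt_comp_add_right w).2 (hxg.differentiable one_ne_zero _)
    obtain ⟨K₁, hK₁, hO⟩ := hd.isBigO_sub.exists_pos
    have hO' : ∀ᶠ z' : M in 𝓝 x.2,
        ‖g x.1 (z' + w) - g x.1 (x.2 + w)‖ ≤ K₁ * ‖(z' : H) - x.2‖ :=
      continuousAt_subtype_val.eventually hO.bound
    refine ⟨2 * N * (2 * K₁ + K * ‖g x.1 (x.2 + w)‖ + K * ‖w‖), ?_⟩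
    filter_upwards [hO', hslice hxa, hxU] with z' h1 h2 hz' w' hw' hw'0
    -- As `w` solves the equation at `x.2`, its residual at `z'` comes only from the change of base
    -- point and of projection.
    have h3 : lyapunovSchmidtMap (P z') (g x.1) z' w =
        (ContinuousLinearMap.id ℝ H - P z') (g x.1 (z' + w) - g x.1 (x.2 + w)) -
          (P z' - P x.2) (g x.1 (x.2 + w)) + (P z' - P x.2) w := by
      rw [← sub_zero (lyapunovSchmidtMap (P z') (g x.1) z' w), ← hw0]
      simp only [lyapunovSchmidtMap, sub_apply, ContinuousLinearMap.id_apply,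
        map_sub]
      abel
    have hPz := hPU _ (mem_of_mem_nhds hxU) _ hz'
    have h4 : ‖lyapunovSchmidtMap (P z') (g x.1) z' w‖ ≤
        (2 * K₁ + K * ‖g x.1 (x.2 + w)‖ + K * ‖w‖) * ‖(z' : H) - x.2‖ := by
      rw [h3]
      refine (norm_add_le _ _).trans ?_
      have a1 := norm_sub_le ((ContinuousLinearMap.id ℝ H - P z')
        (g x.1 (z' + w) - g x.1 (x.2 + w))) ((P z' - P x.2) (g x.1 (x.2 + w)))
      have a2 := hQ1 z' (g x.1 (z' + w) - g x.1 (x.2 + w))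
      have a3 := (P z' - P x.2).le_of_opNorm_le hPz (g x.1 (x.2 + w))
      have a4 := (P z' - P x.2).le_of_opNorm_le hPz w
      linarith
    have h5 := h2 w' (mem_ball_zero_iff.2 hw') w (mem_ball_zero_iff.2 hw)
    simp only [hw'0, zero_sub] at h5
    -- The term `κ * ‖w' - w‖` is absorbed by `hinv`, since `κ` is half of `N⁻¹`.
    have h6 : ‖e (w' - w)‖ ≤ κ * ‖w' - w‖ + ‖lyapunovSchmidtMap (P z') (g x.1) z' w‖ := by
      have : e (w' - w) = -(-lyapunovSchmidtMap (P z') (g x.1) z' w - (e : H →L[ℝ] H) (w' - w)) -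
          lyapunovSchmidtMap (P z') (g x.1) z' w := by
        rw [ContinuousLinearEquiv.coe_coe]; abel
      rw [this]
      refine (norm_sub_le _ _).trans ?_
      rw [norm_neg]
      gcongr
    have h7 := hinv (w' - w)
    rw [hκ] at h6
    have h8 : N⁻¹ * ‖w' - w‖ ≤ 2 * ‖lyapunovSchmidtMap (P z') (g x.1) z' w‖ := by linarith
    rw [inv_mul_le_iff₀ hN0] at h8
    calc ‖w' - w‖ ≤ N * (2 * ‖lyapunovSchmidtMap (P z') (g x.1) z' w‖) := h8
      _ ≤ N * (2 * ((2 * K₁ + K * ‖g x.1 (x.2 + w)‖ + K * ‖w‖) * ‖(z' : H) - x.2‖)) := by gcongr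
      _ = _ := by ring

/-- Constrained maxima over the natural constraint `{z + w z}` are free critical points. -/
theorem eq_zero_of_eventually_le [CompleteSpace H] {M : Set H} {T : M → Submodule ℝ H}
    [∀ z, (T z).HasOrthogonalProjection] {f : H → ℝ} {z : M} {w : M → H} {τ : H}
    (hf : HasGradientAt f τ (z + w z)) (hτ : τ ∈ T z)
    (hw : ∀ᶠ z' in 𝓝 z, w z' ∈ (T z')ᗮ) {K : ℝ}
    (hK : ∀ᶠ z' in 𝓝 z, ‖w z' - w z‖ ≤ K * ‖(z' : H) - z‖) {K₂ b : ℝ} (hK₂ : 0 ≤ K₂)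
    (hT : ∀ᶠ z' in 𝓝 z,
      ‖(T z').starProjection - (T z).starProjection‖ ≤ K₂ * ‖(z' : H) - z‖)
    (hb : ∀ᶠ z' in 𝓝 z, ‖w z'‖ ≤ b) (hKb : K₂ * b < 1)
    (hmax : ∀ᶠ z' in 𝓝 z, f (z' + w z') ≤ f (z + w z))
    {ρ : H → H} (hρM : ∀ y, ρ y ∈ M) (hρz : ρ z = z) (hρ : DifferentiableAt ℝ ρ z)
    (hρτ : fderiv ℝ ρ z τ = τ) : τ = 0 := by
  -- The retraction turns the line through `z` in direction `τ` into a curve in `M` with velocity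
  -- `τ`.
  set c : ℝ → M := fun t => ⟨ρ (z + t • τ), hρM _⟩ with hc
  have hline : HasDerivAt (fun t : ℝ => (z : H) + t • τ) τ 0 := by
    simpa using ((hasDerivAt_id (0 : ℝ)).smul_const τ).const_add (z : H)
  have hcd : HasDerivAt (fun t => (c t : H)) τ 0 := by
    have h1 : HasFDerivAt ρ (fderiv ℝ ρ z) ((z : H) + (0 : ℝ) • τ) := by
      simpa using hρ.hasFDerivAt
    have h2 := h1.comp_hasDerivAt (0 : ℝ) hline
    rwa [hρτ] at h2
  have hc0 : c 0 = z := Subtype.ext (by simp [hc, hρz])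
  have hct : Tendsto c (𝓝[>] 0) (𝓝 z) := by
    rw [tendsto_subtype_rng]
    have := hcd.continuousAt.tendsto
    rw [hc0] at this
    exact this.mono_left nhdsWithin_le_nhds
  have ho : (fun t => (c t : H) - z - t • τ) =o[𝓝[>] 0] (fun t : ℝ => t) := by
    have h1 := hcd.isLittleO.mono (nhdsWithin_le_nhds (s := Ioi (0 : ℝ)))
    simpa [hc0] using h1
  have hKc : ∀ᶠ t in 𝓝[>] (0 : ℝ), ‖w (c t) - w z‖ ≤ K * ‖(c t : H) - z‖ := hct.eventually hK
  have hu : Tendsto (fun t => (c t : H) + w (c t)) (𝓝[>] 0) (𝓝 (z + w z)) := by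
    have h1 : Tendsto (fun t => (c t : H)) (𝓝[>] 0) (𝓝 (z : H)) :=
      (continuous_subtype_val.tendsto z).comp hct
    refine h1.add ?_
    rw [tendsto_iff_norm_sub_tendsto_zero]
    refine squeeze_zero' (Eventually.of_forall fun _ => norm_nonneg _) hKc ?_
    have h2 := (tendsto_iff_norm_sub_tendsto_zero.1 h1).const_mul K
    simpa using h2
  have hwz : inner ℝ τ (w z) = 0 := (Submodule.mem_orthogonal _ _).1 hw.self_of_nhds _ hτ
  have hKz : 0 ≤ |K| := abs_nonneg K
  -- Expand `f` along `c t + w (c t)` and divide by `t > 0`; every little-o error is measured by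
  -- `η`.
  have key : ∀ η : ℝ, 0 < η → ‖τ‖ ^ 2 ≤
      ‖τ‖ * η + η * ((1 + |K|) * (‖τ‖ + η)) + K₂ * b * (‖τ‖ * (‖τ‖ + η)) := by
    intro η hη
    have hfo := hu.eventually ((hasFDerivAt_iff_isLittleO.1 hf.hasFDerivAt).bound hη)
    obtain ⟨t, hft, hot, hKt, hTt, hbt, hmt, hwt, ht⟩ :=
      (hfo.and ((ho.bound hη).and (hKc.and ((hct.eventually hT).and ((hct.eventually hb).and
        ((hct.eventually hmax).and ((hct.eventually hw).and self_mem_nhdsWithin))))))).exists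
    have ht0 : 0 < t := ht
    rw [Real.norm_of_nonneg ht0.le] at hot
    set a := (c t : H) - z - t • τ with ha
    have hca : (c t : H) - z = t • τ + a := by rw [ha]; abel
    have hcn : ‖(c t : H) - z‖ ≤ t * (‖τ‖ + η) := by
      rw [hca]
      refine (norm_add_le _ _).trans ?_
      rw [norm_smul, Real.norm_of_nonneg ht0.le]
      linarith
    have hn : ‖(c t : H) + w (c t) - (z + w z)‖ ≤ (1 + |K|) * (t * (‖τ‖ + η)) := by
      have e1 : (c t : H) + w (c t) - (z + w z) = ((c t : H) - z) + (w (c t) - w z) := by abel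
      rw [e1]
      refine (norm_add_le _ _).trans ?_
      have h1 : K * ‖(c t : H) - z‖ ≤ |K| * ‖(c t : H) - z‖ :=
        mul_le_mul_of_nonneg_right (le_abs_self K) (norm_nonneg _)
      have h2 := mul_le_mul_of_nonneg_left hcn hKz
      linarith
    -- Since `w (c t) ⟂ T (c t)` and `τ ∈ T z`, only the variation of the projection contributes.
    have hwt' : -(K₂ * b * (‖τ‖ * (t * (‖τ‖ + η)))) ≤ inner ℝ τ (w (c t)) := by
      have e1 : inner ℝ τ (w (c t)) =
          -inner ℝ (((T (c t)).starProjection - (T z).starProjection) τ) (w (c t)) := by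
        have h1 : inner ℝ ((T (c t)).starProjection τ) (w (c t)) = 0 :=
          (Submodule.mem_orthogonal _ _).1 hwt _ ((T (c t)).starProjection_apply_mem τ)
        rw [sub_apply, inner_sub_left, h1,
          (T z).starProjection_eq_self_iff.2 hτ]
        ring
      rw [e1, neg_le_neg_iff]
      refine (real_inner_le_norm _ _).trans ?_
      have h2 := ((T (c t)).starProjection - (T z).starProjection).le_of_opNorm_le hTt τ
      calc _ ≤ (K₂ * ‖(c t : H) - z‖ * ‖τ‖) * b := by gcongr
        _ ≤ (K₂ * (t * (‖τ‖ + η)) * ‖τ‖) * b := by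
          have : 0 ≤ b := (norm_nonneg _).trans hbt
          gcongr
        _ = _ := by ring
    have hτa : -(‖τ‖ * (η * t)) ≤ inner ℝ τ a := by
      have h1 := abs_real_inner_le_norm τ a
      have h2 : ‖τ‖ * ‖a‖ ≤ ‖τ‖ * (η * t) := by gcongr
      linarith [neg_abs_le (inner ℝ τ a)]
    have hin : inner ℝ τ ((c t : H) + w (c t) - (z + w z)) =
        t * ‖τ‖ ^ 2 + inner ℝ τ a + inner ℝ τ (w (c t)) := by
      have e1 : (c t : H) + w (c t) - (z + w z) = t • τ + a + w (c t) - w z := by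
        rw [← hca]; abel
      rw [e1, inner_sub_right, inner_add_right, inner_add_right, hwz, inner_smul_right,
        real_inner_self_eq_norm_sq]
      ring
    rw [InnerProductSpace.toDual_apply_apply, hin, Real.norm_eq_abs] at hft
    have h3 := neg_abs_le (f (c t + w (c t)) - f (z + w z) -
      (t * ‖τ‖ ^ 2 + inner ℝ τ a + inner ℝ τ (w (c t))))
    have h4 := mul_le_mul_of_nonneg_left hn hη.le
    have h5 : t * ‖τ‖ ^ 2 ≤ t * (‖τ‖ * η + η * ((1 + |K|) * (‖τ‖ + η)) +
        K₂ * b * (‖τ‖ * (‖τ‖ + η))) := by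
      linarith
    exact le_of_mul_le_mul_left h5 ht0
  -- Letting `η → 0` leaves `‖τ‖² ≤ K₂ b ‖τ‖²` with `K₂ b < 1`.
  have hlim : Tendsto (fun η : ℝ => ‖τ‖ * η + η * ((1 + |K|) * (‖τ‖ + η)) +
      K₂ * b * (‖τ‖ * (‖τ‖ + η))) (𝓝[>] 0) (𝓝 (K₂ * b * ‖τ‖ ^ 2)) := by
    have h1 : Continuous (fun η : ℝ => ‖τ‖ * η + η * ((1 + |K|) * (‖τ‖ + η)) +
      K₂ * b * (‖τ‖ * (‖τ‖ + η))) := by fun_prop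
    have h2 := (h1.tendsto 0).mono_left (nhdsWithin_le_nhds (s := Ioi (0 : ℝ)))
    convert h2 using 2
    ring
  have hle := ge_of_tendsto hlim (eventually_nhdsWithin_of_forall fun η hη => key η hη)
  have h0 : ‖τ‖ ^ 2 ≤ 0 := by nlinarith [sq_nonneg ‖τ‖]
  exact norm_eq_zero.1 (pow_eq_zero_iff two_ne_zero |>.1 (le_antisymm h0 (sq_nonneg _)))

end LyapunovSchmidt

/-! ### Uniform reduction on compact sets and existence of critical points. -/

section Existence

variable {H : Type*} [NormedAddCommGroup H] [InnerProductSpace ℝ H] [CompleteSpace H]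
  {L₀ Γ : H → ℝ} {L : ℝ → H → ℝ} {d : ℕ} {M : Set H} [ChartedSpace (EuclideanSpace ℝ (Fin d)) M]

/-- The auxiliary Lyapunov–Schmidt equation is solvable at `z`, with quantitative control. -/
def IsLyapunovSchmidtSolvable (d : ℕ) [ChartedSpace (EuclideanSpace ℝ (Fin d)) M]
    (L : ℝ → H → ℝ) (C r K ε : ℝ) (z : M) : Prop :=
  (∃ w : H, ‖w‖ ≤ C * |ε| ∧
    lyapunovSchmidtMap (tangentSubspace d z).starProjection (gradient (L ε)) z w = 0) ∧
  (∀ w : H, ‖w‖ < r →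
    lyapunovSchmidtMap (tangentSubspace d z).starProjection (gradient (L ε)) z w = 0 →
      ∃ K : ℝ, ∀ᶠ z' in 𝓝 z, ∀ w' : H, ‖w'‖ < r →
        lyapunovSchmidtMap (tangentSubspace d z').starProjection (gradient (L ε)) z' w' = 0 →
          ‖w' - w‖ ≤ K * ‖(z' : H) - z‖) ∧
  ∀ᶠ z' in 𝓝 z, ‖(tangentSubspace d z').starProjection - (tangentSubspace d z).starProjection‖ ≤
    K * ‖(z' : H) - z‖

theorem IsLyapunovSchmidtSolvable.mono {C C' r r' K K' ε : ℝ} {z : M} (hC : C ≤ C')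
    (hr : r' ≤ r) (hK : K ≤ K') (h : IsLyapunovSchmidtSolvable d L C r K ε z) :
    IsLyapunovSchmidtSolvable d L C' r' K' ε z := by
  obtain ⟨⟨w, hw, hw0⟩, h2, h3⟩ := h
  refine ⟨⟨w, hw.trans (by gcongr), hw0⟩, fun w hw hw0 => ?_, ?_⟩
  · obtain ⟨K, hK⟩ := h2 w (hw.trans_le hr) hw0
    exact ⟨K, hK.mono fun z' h w' hw' => h w' (hw'.trans_le hr)⟩
  · exact h3.mono fun z' h => h.trans (by gcongr)

section

variable (hL₀ : ContDiff ℝ 2 L₀) (hΓ : ContDiff ℝ 2 Γ)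
  (hL : ∀ᶠ ε in 𝓝 (0 : ℝ), ContDiff ℝ 2 (L ε))
  (hexp : IsLittleOInC2 (fun ε z => L ε z - (L₀ z + ε * Γ z)))
  (hM : IsC2Submanifold d M)
  (hA1 : ∀ z : M, gradient L₀ (z : H) = 0)
  (hA2 : ∀ z : M, tangentSubspace d z = (hessian L₀ (z : H)).ker)
  (hA3 : ∀ z : M, IsFredholmIndexZero (hessian L₀ (z : H)))

include hL₀ hΓ hL hexp hM hA1 hA2 hA3

theorem exists_isLyapunovSchmidtSolvable_nhds (z₀ : M) :
    ∃ C > 0, ∃ r > 0, ∃ K > 0, ∀ᶠ x : ℝ × M in 𝓝 (0, z₀),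
      IsLyapunovSchmidtSolvable d L C r K x.1 x.2 := by
  obtain ⟨e, he⟩ := exists_equiv_of_isFredholm (inner_hessian_comm hL₀ (z₀ : H)) (hA3 z₀).1
    (hA2 z₀)
  obtain ⟨C₀, hC₀, hb⟩ := exists_norm_gradient_sub_le hL₀ hΓ hL hexp (z₀ : H)
  have hP := hM.exists_lipschitz_starProjection z₀
  have ht : Tendsto (fun x : ℝ × M => (x.1, (x.2 : H))) (𝓝 (0, z₀)) (𝓝 0 ×ˢ 𝓝 (z₀ : H)) := by
    rw [← nhds_prod_eq]
    have : Continuous (fun x : ℝ × M => (x.1, (x.2 : H))) := by fun_prop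
    exact this.tendsto (0, z₀)
  have hb' : ∀ᶠ x : ℝ × M in 𝓝 (0, z₀), ‖gradient (L x.1) x.2‖ ≤ C₀ * |x.1| := by
    filter_upwards [ht.eventually hb] with x hx
    simpa [hA1 x.2] using hx
  obtain ⟨C, hC, r, hr, h⟩ := exists_lyapunovSchmidt
    (P := fun z : M => (tangentSubspace d z).starProjection) (g := fun ε => gradient (L ε))
    (fun z => Submodule.starProjection_norm_le _) hP (hL.mono fun ε h => h.gradient)
    (tendsto_hessian hL₀ hΓ hL hexp (z₀ : H)) ⟨C₀, hC₀, hb'⟩ he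
  obtain ⟨K, hK, U, hU, hKU⟩ := hP
  refine ⟨C, hC, r, hr, K, hK, ?_⟩
  filter_upwards [h, (continuous_snd.tendsto ((0 : ℝ), z₀)).eventually
    (eventually_mem_nhds_iff.2 hU)] with x hx hxU
  exact ⟨hx.1, hx.2, Filter.mem_of_superset hxU fun z' hz' => hKU _ (mem_of_mem_nhds hxU) _ hz'⟩

/-- The local constants are valid on product neighbourhoods of `(0, z)`; finitely many cover `S`,
and solvability survives enlarging `C`, `K` and shrinking `r`. -/
theorem exists_isLyapunovSchmidtSolvable {S : Set M} (hS : IsCompact S) :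
    ∃ C > 0, ∃ r > 0, ∃ K > 0, ∀ᶠ ε : ℝ in 𝓝 0, ∀ z ∈ S,
      IsLyapunovSchmidtSolvable d L C r K ε z := by
  refine hS.induction_on (p := fun S => ∃ C > 0, ∃ r > 0, ∃ K > 0, ∀ᶠ ε : ℝ in 𝓝 0, ∀ z ∈ S,
      IsLyapunovSchmidtSolvable d L C r K ε z) ?_ ?_ ?_ ?_
  · exact ⟨1, one_pos, 1, one_pos, 1, one_pos, by simp⟩
  · rintro s t hst ⟨C, hC, r, hr, K, hK, h⟩
    exact ⟨C, hC, r, hr, K, hK, h.mono fun ε h z hz => h z (hst hz)⟩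
  · rintro s t ⟨C, hC, r, hr, K, hK, h⟩ ⟨C', hC', r', hr', K', hK', h'⟩
    refine ⟨max C C', lt_max_of_lt_left hC, min r r', lt_min hr hr', max K K',
      lt_max_of_lt_left hK, ?_⟩
    filter_upwards [h, h'] with ε h h'
    rintro z (hz | hz)
    · exact (h z hz).mono (le_max_left _ _) (min_le_left _ _) (le_max_left _ _)
    · exact (h' z hz).mono (le_max_right _ _) (min_le_right _ _) (le_max_right _ _)
  · intro z _
    obtain ⟨C, hC, r, hr, K, hK, h⟩ :=
      exists_isLyapunovSchmidtSolvable_nhds hL₀ hΓ hL hexp hM hA1 hA2 hA3 z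
    rw [nhds_prod_eq] at h
    obtain ⟨pa, ha, pb, hb, hab⟩ := eventually_prod_iff.1 h
    exact ⟨_, mem_nhdsWithin_of_mem_nhds hb, C, hC, r, hr, K, hK,
      ha.mono fun ε hε z hz => hab hε hz⟩

/-- If `Γ` takes strictly larger (or strictly smaller) values at a point `zbar` of a compact
subset `S` of the critical manifold than on the boundary of `S`, the perturbed functionals have
critical points near `S`. -/
theorem exists_critical_of_boundary_gap {S : Set M} (hS : IsCompact S) {zbar : M}
    (hz : zbar ∈ S) (hconst : ∀ z ∈ S, L₀ z = L₀ zbar) {s δ : ℝ} (hs : |s| = 1) (hδ : 0 < δ)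
    (hgap : ∀ z ∈ S, z ∉ interior S → s * Γ z + δ ≤ s * Γ zbar) :
    ∃ ε₀ > (0 : ℝ), ∃ C > (0 : ℝ), ∀ ε : ℝ, |ε| < ε₀ →
      ∃ (z : M) (w : H), w ∈ (tangentSubspace d z)ᗮ ∧ ‖w‖ ≤ C * |ε| ∧
        HasGradientAt (L ε) 0 ((z : H) + w) := by
  obtain ⟨C, hC, r, hr, K, hK, hsol⟩ :=
    exists_isLyapunovSchmidtSolvable hL₀ hΓ hL hexp hM hA1 hA2 hA3 hS
  -- With `‖w‖ ≤ C|ε|` this tolerance makes the expansion error at most `δ|ε|/4`.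
  have hη : 0 < δ / (4 * (1 + C)) := by positivity
  have hexpS : ∀ᶠ x : ℝ × H in 𝓝 (0, 0), ∀ z ∈ S,
      |L x.1 (z + x.2) - (L₀ z + x.1 * Γ z)| ≤ δ / (4 * (1 + C)) * (|x.1| + ‖x.2‖) := by
    refine hS.eventually_forall_of_forall_eventually (P := fun (x : ℝ × H) (z : M) =>
      |L x.1 (z + x.2) - (L₀ z + x.1 * Γ z)| ≤ δ / (4 * (1 + C)) * (|x.1| + ‖x.2‖)) ?_
    intro z _
    have ht : Tendsto (fun x : (ℝ × H) × M => (x.1, (x.2 : H))) (𝓝 ((0, 0), z))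
        (𝓝 ((0, 0), (z : H))) := by
      have : Continuous (fun x : (ℝ × H) × M => (x.1, (x.2 : H))) := by fun_prop
      exact this.tendsto ((0, 0), z)
    exact ht.eventually (eventually_abs_sub_le hL₀ hΓ hexp (hA1 z) hη)
  obtain ⟨ρ, hρ, hρS⟩ := Metric.eventually_nhds_iff.1 hexpS
  have hsmall : ∀ᶠ ε : ℝ in 𝓝 0, |ε| < ρ ∧ C * |ε| < ρ ∧ C * |ε| < r ∧ K * (C * |ε|) < 1 := by
    have h0 : ∀ a b : ℝ, 0 < b → ∀ᶠ ε : ℝ in 𝓝 0, a * |ε| < b := by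
      intro a b hb
      have : Continuous (fun ε : ℝ => a * |ε|) := by fun_prop
      exact (this.tendsto 0).eventually (gt_mem_nhds (by simpa using hb))
    filter_upwards [h0 1 ρ hρ, h0 C ρ hρ, h0 C r hr, h0 (K * C) 1 one_pos] with ε h1 h2 h3 h4
    exact ⟨by simpa using h1, h2, h3, by rwa [mul_assoc] at h4⟩
  obtain ⟨ε₀, hε₀, hall⟩ := Metric.eventually_nhds_iff.1 (hsol.and (hsmall.and hL))
  refine ⟨ε₀, hε₀, C, hC, fun ε hε => ?_⟩
  obtain ⟨hsol, ⟨hερ, hCρ, hCr, hKC⟩, hLε⟩ := hall (by simpa using hε : dist ε 0 < ε₀)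
  have hgrad : ∀ u, HasGradientAt (L ε) (gradient (L ε) u) u :=
    fun u => (hLε.differentiable two_ne_zero u).hasGradientAt
  rcases eq_or_ne ε 0 with rfl | hε0
  · refine ⟨zbar, 0, zero_mem _, by simp, ?_⟩
    obtain ⟨C₀, -, hb⟩ := exists_norm_gradient_sub_le hL₀ hΓ hL hexp (zbar : H)
    rw [← nhds_prod_eq] at hb
    have h1 := hb.self_of_nhds
    simp only [hA1, sub_zero, abs_zero, mul_zero, norm_le_zero_iff] at h1
    rw [add_zero, ← h1]
    exact hgrad _
  have hε1 : 0 < |ε| := abs_pos.2 hε0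
  -- The sign `σ` turns `εΓ` into `|ε| (sΓ)`, so a maximum is sought for either sign of `ε`.
  obtain ⟨σ, hσ1, hσ⟩ : ∃ σ : ℝ, |σ| = 1 ∧ σ * ε = s * |ε| := by
    rcases lt_or_gt_of_ne hε0 with h | h
    · exact ⟨-s, by simpa using hs, by rw [abs_of_neg h]; ring⟩
    · exact ⟨s, hs, by rw [abs_of_pos h]⟩
  -- The choice is made pointwise; its continuity follows because any two small solutions at nearby
  -- base points satisfy the Lipschitz estimate.
  choose! w hwC hw0 using fun z hz => (hsol z hz).1
  have hwz : ∀ z ∈ S, w z ∈ (tangentSubspace d z)ᗮ ∧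
      gradient (L ε) (z + w z) ∈ tangentSubspace d z :=
    fun z hz => lyapunovSchmidtMap_eq_zero_iff.1 (hw0 z hz)
  have hlip : ∀ z ∈ S, ∃ K : ℝ, ∀ᶠ z' in 𝓝[S] z, ‖w z' - w z‖ ≤ K * ‖(z' : H) - z‖ := by
    intro z hz
    obtain ⟨K', hK'⟩ := (hsol z hz).2.1 (w z) ((hwC z hz).trans_lt hCr) (hw0 z hz)
    refine ⟨K', ?_⟩
    filter_upwards [nhdsWithin_le_nhds hK', self_mem_nhdsWithin] with z' h hz'
    exact h _ ((hwC z' hz').trans_lt hCr) (hw0 z' hz')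
  have hcont : ContinuousOn (fun z : M => σ * L ε (z + w z)) S := by
    have hwc : ContinuousOn w S := by
      intro z hz
      obtain ⟨K', hK'⟩ := hlip z hz
      rw [ContinuousWithinAt, tendsto_iff_norm_sub_tendsto_zero]
      refine squeeze_zero' (Eventually.of_forall fun _ => norm_nonneg _) hK' ?_
      have : Continuous (fun z' : M => K' * ‖(z' : H) - z‖) := by fun_prop
      simpa using (this.tendsto z).mono_left nhdsWithin_le_nhds
    exact continuousOn_const.mul
      (hLε.continuous.comp_continuousOn (continuous_subtype_val.continuousOn.add hwc))
  obtain ⟨z, hzS, hzmax⟩ := hS.exists_isMaxOn ⟨zbar, hz⟩ hcont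
  have hest : ∀ z ∈ S, |σ * L ε (z + w z) - (σ * L₀ zbar + |ε| * (s * Γ z))| ≤ δ / 4 * |ε| := by
    intro z hzS
    have h1 := hρS (y := (ε, w z))
      (by simpa [Prod.dist_eq] using ⟨hερ, (hwC z hzS).trans_lt hCρ⟩) z hzS
    have e1 : σ * L ε (z + w z) - (σ * L₀ zbar + |ε| * (s * Γ z)) =
        σ * (L ε (z + w z) - (L₀ z + ε * Γ z)) := by
      rw [hconst z hzS]
      linear_combination (Γ z) * hσ
    rw [e1, abs_mul, hσ1, one_mul]
    refine h1.trans ?_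
    calc δ / (4 * (1 + C)) * (|ε| + ‖w z‖) ≤ δ / (4 * (1 + C)) * (|ε| + C * |ε|) := by
          gcongr; exact hwC z hzS
      _ = δ / 4 * |ε| := by field_simp
  -- Off the interior the gap `δ|ε|` exceeds the two errors `δ|ε|/4`, so `zbar` would give a larger
  -- value.
  have hzint : z ∈ interior S := by
    by_contra hni
    have h1 := abs_le.1 (hest z hzS)
    have h2 := abs_le.1 (hest zbar hz)
    have h3 := mul_le_mul_of_nonneg_left (hgap z hzS hni) hε1.le
    have h4 : σ * L ε (zbar + w zbar) ≤ σ * L ε (z + w z) := hzmax hz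
    nlinarith [mul_pos hδ hε1]
  have hSn : S ∈ 𝓝 z := mem_interior_iff_mem_nhds.1 hzint
  obtain ⟨K', hK'⟩ := hlip z hzS
  rw [nhdsWithin_eq_nhds.2 hSn] at hK'
  obtain ⟨R, hR, hRM, hRz⟩ := hM.exists_retraction z
  obtain ⟨hR1, hR2, -, hR4⟩ := hRz.self_of_nhds
  have hσg : HasGradientAt (fun u => σ * L ε u) (σ • gradient (L ε) (z + w z)) (z + w z) := by
    rw [hasGradientAt_iff_hasFDerivAt, map_smul]
    exact (hasGradientAt_iff_hasFDerivAt.1 (hgrad _)).const_mul σ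
  have hτ : σ • gradient (L ε) (z + w z) ∈ tangentSubspace d z :=
    Submodule.smul_mem _ _ (hwz z hzS).2
  have hzero : σ • gradient (L ε) (z + w z) = 0 :=
    eq_zero_of_eventually_le (T := fun z : M => tangentSubspace d z) hσg hτ
      (by filter_upwards [hSn] with z' hz' using (hwz z' hz').1) hK' hK.le (hsol z hzS).2.2
      (by filter_upwards [hSn] with z' hz' using hwC z' hz') hKC
      (by filter_upwards [hSn] with z' hz' using hzmax hz') hRM hR1 hR2 (hR4 _ hτ)
  have hσ0 : σ ≠ 0 := by
    rintro rfl
    simp at hσ1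
  refine ⟨z, w z, (hwz z hzS).1, hwC z hzS, ?_⟩
  rw [← (smul_eq_zero.1 hzero).resolve_left hσ0]
  exact hgrad _

end

/-- A functional is locally constant on a submanifold consisting of critical points. -/
theorem isLocallyConstant_of_gradient_eq_zero (hL₀ : ContDiff ℝ 2 L₀)
    (hM : IsC2Submanifold d M) (hA1 : ∀ z : M, gradient L₀ (z : H) = 0) :
    IsLocallyConstant (fun z : M => L₀ z) := by
  have := hM.1
  have hv : ContMDiff (𝓡 d) 𝓘(ℝ, H) 2 (Subtype.val : M → H) := hM.2.contMDiff
  refine isLocallyConstant_of_mfderiv_eq_zero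
    ((hL₀.contMDiff.comp hv).of_le (by norm_num)) fun z => ?_
  have h1 : HasFDerivAt L₀ (0 : H →L[ℝ] ℝ) z := by
    have h2 := (hL₀.differentiable two_ne_zero (z : H)).hasGradientAt
    rw [hA1, hasGradientAt_iff_hasFDerivAt, map_zero] at h2
    exact h2
  have h3 := h1.hasMFDerivAt.comp z ((hv z).mdifferentiableAt two_ne_zero).hasMFDerivAt
  exact h3.mfderiv.trans (ContinuousLinearMap.zero_comp _)

/-- A function on a product whose derivative vanishes along the second factor is locally constant
on the slices. -/
theorem isLocallyConstant_slice {p q : ℕ}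
    {G : Type*} [TopologicalSpace G] [ChartedSpace (EuclideanSpace ℝ (Fin p)) G]
    {N : Type*} [TopologicalSpace N] [ChartedSpace (EuclideanSpace ℝ (Fin q)) N]
    [IsManifold (𝓡 q) 2 N] {f : G × N → ℝ}
    (hf : ContMDiff ((𝓡 p).prod (𝓡 q)) 𝓘(ℝ, ℝ) 1 f)
    (h0 : ∀ (g : G) (γ : N) (v : TangentSpace (𝓡 q) γ),
      mfderiv ((𝓡 p).prod (𝓡 q)) 𝓘(ℝ, ℝ) f (g, γ) ((0 : TangentSpace (𝓡 p) g), v) = 0)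
    (g : G) : IsLocallyConstant (fun γ : N => f (g, γ)) := by
  have hs : ContMDiff (𝓡 q) ((𝓡 p).prod (𝓡 q)) 1 (fun γ : N => (g, γ)) :=
    contMDiff_const.prodMk contMDiff_id
  refine isLocallyConstant_of_mfderiv_eq_zero (hf.comp hs) fun γ => ?_
  have h1 := ((hf (g, γ)).mdifferentiableAt one_ne_zero).hasMFDerivAt.comp γ
    ((hs γ).mdifferentiableAt one_ne_zero).hasMFDerivAt
  have h2 : mfderiv (𝓡 q) 𝓘(ℝ, ℝ) (f ∘ fun γ : N => (g, γ)) γ = _ := h1.mfderiv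
  rw [mfderiv_prod_right] at h2
  refine h2.trans ?_
  ext v
  exact h0 g γ v

end Existence

/-! ### The compact region around the strict extremum. -/

theorem theorem2p2
    {H : Type*} [NormedAddCommGroup H] [InnerProductSpace ℝ H] [CompleteSpace H]
    -- the unperturbed functional, the perturbation, and the family `L ε = L₀ + ε Γ + o(ε)`
    (L₀ Γ : H → ℝ) (L : ℝ → H → ℝ)
    (hL₀ : ContDiff ℝ 2 L₀) (hΓ : ContDiff ℝ 2 Γ)
    (hL : ∀ᶠ ε in 𝓝 (0 : ℝ), ContDiff ℝ 2 (L ε))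
    (hexp : IsLittleOInC2 (fun ε z => L ε z - (L₀ z + ε * Γ z)))
    -- (A1): `M` is a `C²`-submanifold consisting of critical points of `L₀`
    {d : ℕ} (M : Set H) [ChartedSpace (EuclideanSpace ℝ (Fin d)) M]
    (hM : IsC2Submanifold d M)
    (hA1 : ∀ z : M, gradient L₀ (z : H) = 0)
    -- (A2): non-degeneracy
    (hA2 : ∀ z : M, tangentSubspace d z = (hessian L₀ (z : H)).ker)
    -- (A3): the Fredholm property
    (hA3 : ∀ z : M, IsFredholmIndexZero (hessian L₀ (z : H)))
    -- (A4): `M` is a trivializable bundle over the compact base `N` with fiber `G`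
    {p q : ℕ}
    {G : Type*} [TopologicalSpace G] [ChartedSpace (EuclideanSpace ℝ (Fin p)) G]
    [IsManifold (𝓡 p) 2 G]
    {N : Type*} [TopologicalSpace N] [ChartedSpace (EuclideanSpace ℝ (Fin q)) N]
    [IsManifold (𝓡 q) 2 N] [CompactSpace N]
    (ϑ : M → N)
    (ι : Diffeomorph ((𝓡 p).prod (𝓡 q)) (𝓡 d) (G × N) M 2)
    (hA4 : ∀ (g : G) (γ : N), ϑ (ι (g, γ)) = γ)
    -- (A5): `T_γ N` lies in the kernel of the differential of `Γ ∘ ι` at `(g, γ)`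
    (hA5 : ∀ (g : G) (γ : N) (v : TangentSpace (𝓡 q) γ),
      mfderiv ((𝓡 p).prod (𝓡 q)) 𝓘(ℝ, ℝ) (fun x : G × N => Γ (ι x)) (g, γ)
        ((0 : TangentSpace (𝓡 p) g), v) = 0)
    -- the fiber function `g ↦ Γ (ι (g, γ₀))` has a strict local extremum at `gbar`
    (γ₀ : N) (gbar : G)
    (hext : IsStrictLocalMax (fun g : G => Γ (ι (g, γ₀))) gbar ∨
      IsStrictLocalMin (fun g : G => Γ (ι (g, γ₀))) gbar) :
    ∃ ε₀ > (0 : ℝ), ∃ C > (0 : ℝ), ∀ ε : ℝ, |ε| < ε₀ →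
      ∃ (z : M) (w : H), w ∈ (tangentSubspace d z)ᗮ ∧ ‖w‖ ≤ C * |ε| ∧
        HasGradientAt (L ε) 0 ((z : H) + w) := by

  have hMm := hM.1
  have : LocallyCompactSpace G := ChartedSpace.locallyCompactSpace (EuclideanSpace ℝ (Fin p)) G
  have : LocallyConnectedSpace G :=
    ChartedSpace.locallyConnectedSpace (EuclideanSpace ℝ (Fin p)) G
  have : LocallyConnectedSpace N :=
    ChartedSpace.locallyConnectedSpace (EuclideanSpace ℝ (Fin q)) N
  have hιc : Continuous ι := ι.continuous
  have hslice : Continuous (fun g : G => ι (g, γ₀)) := hιc.comp (Continuous.prodMk_left γ₀)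
  have : T2Space G := T2Space.of_injective_continuous (f := fun g : G => ι (g, γ₀))
    (fun g g' h => congrArg Prod.fst (ι.injective h)) hslice
  have hcΓ : Continuous (fun g : G => Γ (ι (g, γ₀))) :=
    hΓ.continuous.comp (continuous_subtype_val.comp hslice)
  obtain ⟨s, hs, hstrict⟩ : ∃ s : ℝ, |s| = 1 ∧
      ∀ᶠ g in 𝓝[≠] gbar, s * Γ (ι (g, γ₀)) < s * Γ (ι (gbar, γ₀)) := by
    rcases hext with h | h
    · exact ⟨1, abs_one, h.mono fun g hg => by simpa using hg⟩
    · exact ⟨-1, by simp, h.mono fun g hg => by simpa using hg⟩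
  rw [eventually_nhdsWithin_iff] at hstrict
  obtain ⟨V, hV, hVo, hgV⟩ := eventually_nhds_iff.1 hstrict
  -- `V` provides strictness, the connected component provides constancy of `L₀`.
  obtain ⟨B, hB, hgB, hBU⟩ := exists_compact_subset (hVo.inter isOpen_connectedComponent)
    (show gbar ∈ V ∩ connectedComponent gbar from ⟨hgV, mem_connectedComponent⟩)
  -- `N` may be disconnected. The component of `γ₀` is compact and also open, so it adds no boundary
  -- to the product with `B`.
  have hN : IsCompact (connectedComponent γ₀) := isClosed_connectedComponent.isCompact
  have hΓι : ContMDiff ((𝓡 p).prod (𝓡 q)) 𝓘(ℝ, ℝ) 1 (fun x : G × N => Γ (ι x)) :=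
    (hΓ.contMDiff.comp (hM.2.contMDiff.comp ι.contMDiff)).of_le (by norm_num)
  have hΓconst : ∀ g, ∀ γ ∈ connectedComponent γ₀, Γ (ι (g, γ)) = Γ (ι (g, γ₀)) :=
    fun g γ hγ => (isLocallyConstant_slice hΓι hA5 g).apply_eq_of_isPreconnected
      isPreconnected_connectedComponent hγ mem_connectedComponent
  have hLconst : ∀ g ∈ connectedComponent gbar, ∀ γ ∈ connectedComponent γ₀,
      L₀ (ι (g, γ)) = L₀ (ι (gbar, γ₀)) := fun g hg γ hγ =>
    ((isLocallyConstant_of_gradient_eq_zero hL₀ hM hA1).comp_continuous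
      hιc).apply_eq_of_isPreconnected
      (isPreconnected_connectedComponent.prod isPreconnected_connectedComponent)
      (mk_mem_prod hg hγ) (mk_mem_prod mem_connectedComponent mem_connectedComponent)
  obtain ⟨δ, hδ, hgap⟩ : ∃ δ > 0, ∀ g ∈ B \ interior B,
      s * Γ (ι (g, γ₀)) + δ ≤ s * Γ (ι (gbar, γ₀)) := by
    -- If `B` has no boundary, as can happen when `p = 0`, any positive `δ` works.
    rcases (B \ interior B).eq_empty_or_nonempty with h | h
    · exact ⟨1, one_pos, by simp [h]⟩
    · obtain ⟨g, hg, hmax⟩ := (hB.diff isOpen_interior).exists_isMaxOn h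
        (continuous_const.mul hcΓ : Continuous fun g => s * Γ (ι (g, γ₀))).continuousOn
      have h1 := hV g (hBU hg.1).1 (by rintro rfl; exact hg.2 hgB)
      refine ⟨_, sub_pos.2 h1, fun g' hg' => ?_⟩
      have h2 : s * Γ (ι (g', γ₀)) ≤ s * Γ (ι (g, γ₀)) := hmax hg'
      linarith
  refine exists_critical_of_boundary_gap hL₀ hΓ hL hexp hM hA1 hA2 hA3
    (S := ι '' (B ×ˢ connectedComponent γ₀)) ((hB.prod hN).image hιc)
    (zbar := ι (gbar, γ₀))
    (mem_image_of_mem _ (mk_mem_prod (interior_subset hgB) mem_connectedComponent)) ?_ hs hδ ?_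
  · rintro _ ⟨⟨g, γ⟩, ⟨hg, hγ⟩, rfl⟩
    exact hLconst g (hBU hg).2 γ hγ
  · rintro _ ⟨⟨g, γ⟩, ⟨hg, hγ⟩, rfl⟩ hni
    rw [hΓconst g γ hγ]
    refine hgap g ⟨hg, fun hgi => hni ?_⟩
    have h1 : ι '' (interior B ×ˢ connectedComponent γ₀) ⊆
        interior (ι '' (B ×ˢ connectedComponent γ₀)) :=
      interior_maximal (image_mono (prod_mono_left interior_subset))
        (ι.toHomeomorph.isOpenMap _ (isOpen_interior.prod isOpen_connectedComponent))
    exact h1 (mem_image_of_mem _ (mk_mem_prod hgi hγ))
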